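/- For a real number $x$ let $\Vert x\Vert$ denote the distance from $x$ to the closest integer. For real $\alpha\neq 0$ and $\zeta>1$ put \[ \sigma_n(\alpha,\zeta):=-\frac{\log\Vert\alpha\zeta^n\Vert}{\log|\alpha\zeta^n|} \] (with $\sigma_n(\alpha,\zeta):=\infty$ if $\alpha\zeta^n$ is an integer) and $\overline{\sigma}(\alpha,\zeta):=\limsup_{n\to\infty}\sigma_n(\alpha,\zeta)\in[0,\infty]$. For an algebraic number $z$ let $H(z)$ be the maximum of the absolute values of the coefficients of the minimal polynomial of $z$ over $\mathbb{Z}$ with relatively prime coefficients. (1) Let $\alpha\neq 0$ and $\zeta>1$ be real algebraic numbers such that $(\alpha,\zeta)$ is not of the form $\left(\frac{A}{B}M^{-g/L},M^{1/L}\right)$ with integers $A\neq 0$ and $L,M,B,g>0$. Then $\overline{\sigma}(\alpha,\zeta)<\infty$. In particular, if $\zeta>1$ is a real algebraic number not of the form $M^{1/L}$ with positive integers $L,M$, then $\overline{\sigma}(\alpha,\zeta)<\infty$ for every real algebraic $\alpha\neq 0$. (2) Let $k,t\geq 1$ and $H\geq 2$ be integers. Let $\zeta>1$ be a real algebraic number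 that is not of the form $M_0^{1/L}/N_0$ with positive integers $L,M_0,N_0$, with $[\mathbb{Q}(\zeta):\mathbb{Q}]\leq k$ and $H(\zeta)\leq H$, and let $\alpha\neq 0$ be a real algebraic number with $[\mathbb{Q}(\alpha):\mathbb{Q}]\leq t$. Then \[ \overline{\sigma}(\alpha,\zeta)\leq 2^{k}\sqrt{k}\,t\,H\log H\left(2k-1+\frac{\frac12\log k+\log H}{\log 2}\right)+2^{k}\sqrt{k}\,H\log H-1 . \] In particular $\overline{\sigma}(\alpha,\zeta)<\infty$. -/

import Mathlib

open Polynomial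

namespace PowModOne

/-- The distance `‖x‖` of a real number `x` to the closest integer. -/
noncomputable def distInt (x : ℝ) : ℝ := |x - round x|

open Classical in
/-- `σₙ(α, ζ) = - log ‖α ζⁿ‖ / log |α ζⁿ|`, with the value `∞` if `α ζⁿ` is an integer.
The absolute value in the denominator only matters for negative `α`. -/
noncomputable def sigma (α ζ : ℝ) (n : ℕ) : EReal :=
  if distInt (α * ζ ^ n) = 0 then ⊤
  else ((-(Real.log (distInt (α * ζ ^ n)) / Real.log |α * ζ ^ n|) : ℝ) : EReal)

/-- `σ̄(α, ζ) = limsup σₙ(α, ζ)`, an extended real number. -/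
noncomputable def sigmaSup (α ζ : ℝ) : EReal :=
  Filter.limsup (fun n : ℕ => sigma α ζ n) Filter.atTop

/-- The minimal polynomial over `ℤ`, with relatively prime coefficients, of an algebraic
number `z` (determined up to sign): denominators of the monic minimal polynomial over `ℚ` are
cleared and the content is divided out. -/
noncomputable def intMinpoly (z : ℝ) : ℤ[X] :=
  (IsLocalization.integerNormalization (nonZeroDivisors ℤ) (minpoly ℚ z)).primPart

/-- The height `H(P)`: the maximum of the absolute values of the coefficients of `P`. -/
def polyHeight (P : ℤ[X]) : ℕ := P.support.sup fun i => (P.coeff i).natAbs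

/-- The height `H(z)` of an algebraic number: the height of its minimal polynomial over `ℤ`. -/
noncomputable def height (z : ℝ) : ℕ := polyHeight (intMinpoly z)

/-- The degree `[ℚ(z) : ℚ]`. -/
noncomputable def degree (z : ℝ) : ℕ :=
  Module.finrank ℚ (IntermediateField.adjoin ℚ ({z} : Set ℝ))

/-- `ζ = M^{1/L}` for some positive integers `L, M`. -/
def IsRootOfInt (ζ : ℝ) : Prop :=
  ∃ L M : ℤ, 0 < L ∧ 0 < M ∧ ζ = (M : ℝ) ^ ((1 : ℝ) / L)

/-- `ζ = M₀^{1/L} / N₀` for some positive integers `L, M₀, N₀`. -/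
def IsRootOfIntDiv (ζ : ℝ) : Prop :=
  ∃ L M₀ N₀ : ℤ, 0 < L ∧ 0 < M₀ ∧ 0 < N₀ ∧ ζ = (M₀ : ℝ) ^ ((1 : ℝ) / L) / N₀

/-- `(α, ζ) = ((A / B) M^{-g/L}, M^{1/L})` for some integers `L, M, B, g > 0` and `A ≠ 0`. -/
def IsExceptionalPair (α ζ : ℝ) : Prop :=
  ∃ L M A B g : ℤ, 0 < L ∧ 0 < M ∧ A ≠ 0 ∧ 0 < B ∧ 0 < g ∧
    α = (A : ℝ) / B * (M : ℝ) ^ (-(g : ℝ) / L) ∧ ζ = (M : ℝ) ^ ((1 : ℝ) / L)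

/-- The explicit bound, as a function of the bounds `k`, `t`, `H` for the degree of `ζ`, the
degree of `α` and the height of `ζ`. -/
noncomputable def explicitBound (k t H : ℕ) : ℝ :=
  2 ^ k * √(k : ℝ) * t * (H * Real.log H) *
      (2 * k - 1 + (1 / 2 * Real.log k + Real.log H) / Real.log 2)
    + 2 ^ k * √(k : ℝ) * H * Real.log H - 1

end PowModOne

namespace PowModOne

/-! The core is a Liouville inequality in `K = ℚ(α, ζ)`, of degree `D`. With `a` the leading
coefficient of the integer minimal polynomial of `ζ` and `bα` integral, `y = b aⁿ (α ζⁿ - N)` is an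
algebraic integer. If it is nonzero, its norm is at least `1` in absolute value. Every conjugate is
`O((2H)ⁿ)`, because `|a| |σ ζ| ≤ 2H`; at the given real embedding the factor `|a|ⁿ ≤ (2H/ζ)ⁿ` saves
`ζⁿ`. Hence `ζⁿ ≤ C (2H)^(Dn) ‖α ζⁿ‖` (`exists_pow_le_mul_abs_sub`), and logarithms give `σ̄ ≤ D
log(2H) / log ζ - 1`, provided `α ζⁿ` is an integer only finitely often.

If it is an integer infinitely often, two such terms make a power of `ζ` rational, and the later
ones force that rational to be an integer: this is the exceptional pair.

The explicit bound also needs `log ζ` bounded below. This holds because the minimal polynomial takes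
a nonzero integer value at `1` (`one_le_mul_log_of_root`). -/

/-! ### Heights and the integer minimal polynomial -/

theorem natAbs_coeff_le_polyHeight (P : ℤ[X]) (i : ℕ) : (P.coeff i).natAbs ≤ polyHeight P := by
  by_cases h : i ∈ P.support
  · exact Finset.le_sup (f := fun i => (P.coeff i).natAbs) h
  · simp [notMem_support_iff.mp h]

theorem abs_coeff_le_of_polyHeight_le {P : ℤ[X]} {H : ℕ} (hH : polyHeight P ≤ H) (i : ℕ) :
    |(P.coeff i : ℝ)| ≤ H := by
  have := (natAbs_coeff_le_polyHeight P i).trans hH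
  rw [← Int.cast_abs, Int.abs_eq_natAbs]
  exact_mod_cast this

/-- Cauchy's root bound `‖z‖ < 1 + max |aᵢ| / |a|`, multiplied by `|a|`: both resulting terms are at
most `H`. -/
theorem norm_leadingCoeff_mul_root_le {P : ℤ[X]} (hP : P ≠ 0) {H : ℕ} (hH : polyHeight P ≤ H)
    {z : ℂ} (hz : aeval z P = 0) : |(P.leadingCoeff : ℝ)| * ‖z‖ ≤ 2 * H := by
  have hcoeff (i : ℕ) : |(P.coeff i : ℝ)| ≤ H := abs_coeff_le_of_polyHeight_le hH i
  have hinj : Function.Injective (algebraMap ℤ ℂ) := (algebraMap ℤ ℂ).injective_int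
  have hmap : P.map (algebraMap ℤ ℂ) ≠ 0 := (Polynomial.map_ne_zero_iff hinj).mpr hP
  have hroot : (P.map (algebraMap ℤ ℂ)).IsRoot z := by
    rwa [IsRoot.def, eval_map_algebraMap]
  have hlt : ‖z‖ < _ := NNReal.coe_lt_coe.mpr (hroot.norm_lt_cauchyBound hmap)
  have ha : 0 < |(P.leadingCoeff : ℝ)| := by
    simpa using hP
  set s : NNReal := (Finset.range (P.map (algebraMap ℤ ℂ)).natDegree).sup
    (‖(P.map (algebraMap ℤ ℂ)).coeff ·‖₊) with hs
  have hsH : (s : ℝ) ≤ H := by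
    have : s ≤ (H : NNReal) := by
      refine Finset.sup_le fun i _ => ?_
      rw [← NNReal.coe_le_coe]
      simpa [Int.norm_eq_abs] using hcoeff i
    exact_mod_cast this
  have hlead : ‖(P.map (algebraMap ℤ ℂ)).leadingCoeff‖ = |(P.leadingCoeff : ℝ)| := by
    rw [leadingCoeff_map_of_injective hinj]
    simp
  have hcb : ((P.map (algebraMap ℤ ℂ)).cauchyBound : ℝ) = s / |(P.leadingCoeff : ℝ)| + 1 := by
    rw [cauchyBound, ← hs, ← hlead]
    rfl
  rw [hcb] at hlt
  calc |(P.leadingCoeff : ℝ)| * ‖z‖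
      ≤ |(P.leadingCoeff : ℝ)| * (s / |(P.leadingCoeff : ℝ)| + 1) := by gcongr
    _ = s + |(P.leadingCoeff : ℝ)| := by field_simp
    _ ≤ 2 * H := by
      have : |(P.leadingCoeff : ℝ)| ≤ H := hcoeff P.natDegree
      linarith

theorem aeval_intMinpoly {z : ℝ} (hz : IsAlgebraic ℚ z) : aeval z (intMinpoly z) = 0 := by
  refine aeval_primPart_eq_zero ?_ ?_
  · rw [ne_eq, IsFractionRing.integerNormalization_eq_zero_iff]
    exact minpoly.ne_zero hz.isIntegral
  · exact IsLocalization.integerNormalization_aeval_eq_zero _ _ (minpoly.aeval ℚ z)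

theorem intMinpoly_ne_zero (z : ℝ) : intMinpoly z ≠ 0 := primPart_ne_zero _

theorem natDegree_intMinpoly_le {z : ℝ} (hz : IsAlgebraic ℚ z) :
    (intMinpoly z).natDegree ≤ degree z := by
  rw [intMinpoly, natDegree_primPart, degree, IntermediateField.adjoin.finrank hz.isIntegral]
  exact natDegree_le_natDegree <| degree_mono <|
    IsLocalization.integerNormalization_support _ _

/-- By irreducibility, a root at `1` would make the minimal polynomial divide `X - 1`, forcing `z =
1`. -/
theorem intMinpoly_eval_one_ne_zero {z : ℝ} (hz : IsAlgebraic ℚ z) (h1 : z ≠ 1) :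
    (intMinpoly z).eval 1 ≠ 0 := by
  intro h
  obtain ⟨b, hb, hbp⟩ :=
    IsLocalization.integerNormalization_spec (nonZeroDivisors ℤ) (minpoly ℚ z)
  have h2 : (IsLocalization.integerNormalization (nonZeroDivisors ℤ) (minpoly ℚ z)).eval 1 = 0 := by
    rw [eq_C_content_mul_primPart (IsLocalization.integerNormalization _ _), eval_mul]
    exact mul_eq_zero_of_right _ h
  have h3 : (b • minpoly ℚ z).eval 1 = 0 := by
    rw [← hbp, eval_map_algebraMap, ← map_one (algebraMap ℤ ℚ), aeval_algebraMap_apply]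
    simp [h2]
  have h4 : (minpoly ℚ z).IsRoot 1 := by
    rw [eval_smul, smul_eq_zero] at h3
    exact h3.resolve_left (nonZeroDivisors.ne_zero hb)
  have h5 : minpoly ℚ z ∣ X - C 1 :=
    (irreducible_X_sub_C 1).dvd_symm (minpoly.irreducible hz.isIntegral) (dvd_iff_isRoot.mpr h4)
  have h6 := aeval_eq_zero_of_dvd_aeval_eq_zero h5 (minpoly.aeval ℚ z)
  simp [sub_eq_zero] at h6
  exact h1 h6

/-! ### Lower bound for `log ζ` and comparison with the explicit bound -/

theorem five_mul_sq_le (k : ℕ) (hk : 0 < k) : 5 * (k + 1) ^ 2 ≤ 16 * 2 ^ k := by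
  -- The inductive step needs `(n + 2)² ≤ 2 (n + 1)²`, which fails at `n = 1`.
  obtain rfl | hk2 : k = 1 ∨ 2 ≤ k := by omega
  · norm_num
  induction k, hk2 using Nat.le_induction with
  | base => norm_num
  | succ n hn ih =>
    have := ih (by omega)
    rw [pow_succ 2 n]
    nlinarith

/-- A root `ζ > 1` of an integer polynomial not vanishing at `1` cannot be too close to `1`. -/
theorem one_le_mul_log_of_root {P : ℤ[X]} {k H : ℕ} (hk : 0 < k) (hH2 : 2 ≤ H)
    (hdeg : P.natDegree ≤ k) (hcoeff : ∀ i, |(P.coeff i : ℝ)| ≤ H) {ζ : ℝ} (hζ : 1 < ζ)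
    (hroot : aeval ζ P = 0) (h1 : P.eval 1 ≠ 0) :
    1 ≤ 2 ^ k * √(k : ℝ) * H * Real.log ζ := by
  by_contra! hlt
  set u := Real.log ζ with hu
  have hu0 : 0 < u := Real.log_pos hζ
  have hexp : ζ = Real.exp u := (Real.exp_log (by linarith)).symm
  have hk1 : (1 : ℝ) ≤ k := by exact_mod_cast hk
  have hHr : (2 : ℝ) ≤ H := by exact_mod_cast hH2
  have hs0 : 0 < √(k : ℝ) := Real.sqrt_pos.mpr (by linarith)
  have hs2 : √(k : ℝ) * √(k : ℝ) = k := Real.mul_self_sqrt (by linarith)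
  have hs1 : √(k : ℝ) ≤ (k + 1) / 2 := by nlinarith [sq_nonneg (√(k : ℝ) - 1)]
  have h5 : 5 * ((k : ℝ) + 1) ^ 2 ≤ 16 * 2 ^ k := by exact_mod_cast five_mul_sq_le k hk
  have h2k : (k : ℝ) + 1 ≤ 2 ^ k := by exact_mod_cast Nat.lt_two_pow_self (n := k)
  have hku : (k : ℝ) * u ≤ 1 / 4 := by
    have : 2 ^ k * √(k : ℝ) * 2 * u < 1 := lt_of_le_of_lt (by gcongr) hlt
    have h3 : 2 * √(k : ℝ) ≤ 2 ^ k := by linarith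
    have : 2 * √(k : ℝ) * √(k : ℝ) * 2 * u < 1 := lt_of_le_of_lt (by gcongr) this
    nlinarith
  -- `exp x - 1 ≤ x + x² ≤ 5/4 x` for `0 ≤ x ≤ 1/4`, applied to `x = i u`.
  have hterm (i : ℕ) (hi : i ≤ k) : ζ ^ i - 1 ≤ 5 / 4 * u * i := by
    have hik : (i : ℝ) * u ≤ 1 / 4 :=
      (mul_le_mul_of_nonneg_right (by exact_mod_cast hi) hu0.le).trans hku
    have hi0 : 0 ≤ (i : ℝ) * u := by positivity
    rw [hexp, ← Real.exp_nat_mul]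
    have := (abs_le.mp (Real.abs_exp_sub_one_sub_id_le (x := i * u)
      (by rw [abs_of_nonneg hi0]; linarith))).2
    nlinarith
  -- Subtracting `P(ζ) = 0` writes the nonzero integer `P(1)` through the small quantities `ζ ^ i -
  -- 1`.
  have hval : ((P.eval 1 : ℤ) : ℝ) = -∑ i ∈ Finset.range (k + 1), (P.coeff i : ℝ) * (ζ ^ i - 1) := by
    have e1 : ((P.eval 1 : ℤ) : ℝ) = ∑ i ∈ Finset.range (k + 1), (P.coeff i : ℝ) := by
      rw [eval_eq_sum_range' (Nat.lt_succ_of_le hdeg)]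
      simp
    have e2 : ∑ i ∈ Finset.range (k + 1), (P.coeff i : ℝ) * ζ ^ i = 0 := by
      rw [← hroot, aeval_eq_sum_range' (Nat.lt_succ_of_le hdeg)]
      simp
    simp only [mul_sub, Finset.sum_sub_distrib, mul_one, e2, e1]
    ring
  have hone : (1 : ℝ) ≤ |((P.eval 1 : ℤ) : ℝ)| := by
    rw [← Int.cast_abs]
    exact_mod_cast Int.one_le_abs h1
  have hsum : |((P.eval 1 : ℤ) : ℝ)| ≤ ∑ i ∈ Finset.range (k + 1), (H : ℝ) * (5 / 4 * u * i) := by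
    rw [hval, abs_neg]
    refine (Finset.abs_sum_le_sum_abs _ _).trans (Finset.sum_le_sum fun i hi => ?_)
    have hnn : 0 ≤ ζ ^ i - 1 := by linarith [one_le_pow₀ hζ.le (n := i)]
    rw [abs_mul, abs_of_nonneg hnn]
    exact mul_le_mul (hcoeff i) (hterm i (by simpa [Nat.lt_succ_iff] using hi)) hnn (by positivity)
  have hgauss : ∑ i ∈ Finset.range (k + 1), (i : ℝ) = k * (k + 1) / 2 := by
    have := Finset.sum_range_id_mul_two (k + 1)
    rw [Nat.add_sub_cancel] at this
    have := congrArg (Nat.cast : ℕ → ℝ) this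
    push_cast at this
    linarith
  rw [← Finset.mul_sum, ← Finset.mul_sum, hgauss] at hsum
  have hfin : 5 / 8 * (√(k : ℝ) * (k + 1)) ≤ 2 ^ k := by
    have : √(k : ℝ) * (k + 1) ≤ (k + 1) / 2 * (k + 1) := by gcongr
    nlinarith
  have hfin2 : (√(k : ℝ) * H * u) * (5 / 8 * (√(k : ℝ) * (k + 1))) ≤ (√(k : ℝ) * H * u) * 2 ^ k := by
    gcongr
  have e : (√(k : ℝ) * H * u) * (5 / 8 * (√(k : ℝ) * (k + 1))) = H * (5 / 4 * u * (k * (k + 1) / 2)) := by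
    calc _ = 5 / 8 * (√(k : ℝ) * √(k : ℝ)) * H * u * (k + 1) := by ring
      _ = _ := by rw [hs2]; ring
  linarith

/-- Since `H ≥ 2`, `log (2H) ≤ 2 log H` and the last factor of the first summand is at least `2k`;
that summand alone already dominates. -/
theorem mul_log_two_mul_div_log_le_explicitBound {k t H D : ℕ} (hk : 0 < k) (hH2 : 2 ≤ H)
    (hD : D ≤ t * k) {u : ℝ} (hu : 0 < u) (hgap : 1 ≤ 2 ^ k * √(k : ℝ) * H * u) :
    D * Real.log (2 * H) / u - 1 ≤ explicitBound k t H := by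
  have hHr : (2 : ℝ) ≤ H := by exact_mod_cast hH2
  have hk1 : (1 : ℝ) ≤ k := by exact_mod_cast hk
  have hl2 : 0 < Real.log 2 := Real.log_pos (by norm_num)
  have hlH : Real.log 2 ≤ Real.log H := Real.log_le_log (by norm_num) hHr
  have hlk : 0 ≤ Real.log k := Real.log_nonneg hk1
  have hDr : (D : ℝ) ≤ t * k := by exact_mod_cast hD
  have hlog : Real.log (2 * H) ≤ 2 * Real.log H := by
    rw [Real.log_mul (by norm_num) (by linarith)]
    linarith
  have hlog0 : 0 ≤ Real.log (2 * H) := Real.log_nonneg (by linarith)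
  have hinv : 1 / u ≤ 2 ^ k * √(k : ℝ) * H := by
    rwa [div_le_iff₀ hu]
  have hX : 0 ≤ 2 ^ k * √(k : ℝ) * H := by positivity
  have hfac : 2 * (k : ℝ) ≤ 2 * k - 1 + (1 / 2 * Real.log k + Real.log H) / Real.log 2 := by
    have : 1 ≤ (1 / 2 * Real.log k + Real.log H) / Real.log 2 := by
      rw [le_div_iff₀ hl2]
      linarith
    linarith
  have hlH0 : 0 ≤ Real.log H := by linarith
  have h1 : D * Real.log (2 * H) / u ≤ (t * k) * (2 * Real.log H) * (2 ^ k * √(k : ℝ) * H) := by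
    rw [div_eq_mul_one_div]
    gcongr
  have h2 : 2 ^ k * √(k : ℝ) * t * (H * Real.log H) * (2 * k) ≤ 2 ^ k * √(k : ℝ) * t * (H * Real.log H) *
      (2 * k - 1 + (1 / 2 * Real.log k + Real.log H) / Real.log 2) := by
    gcongr
  have h3 : 0 ≤ 2 ^ k * √(k : ℝ) * H * Real.log H := by positivity
  rw [explicitBound]
  linarith

/-! ### The Liouville inequality -/

/-- The product is the absolute value of the norm of `y`, a nonzero rational integer. -/
theorem one_le_norm_prod_embeddings {K : Type*} [Field K] [NumberField K] {y : K}
    (hy : IsIntegral ℤ y) (hy0 : y ≠ 0) : 1 ≤ ∏ σ : K →ₐ[ℚ] ℂ, ‖σ y‖ := by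
  obtain ⟨m, hm⟩ := IsIntegrallyClosed.isIntegral_iff.mp (Algebra.isIntegral_norm ℚ hy)
  have hm0 : m ≠ 0 := by
    rintro rfl
    exact hy0 ((Algebra.norm_eq_zero_iff (R := ℚ)).mp (by rw [← hm, map_zero]))
  have h := Algebra.norm_eq_prod_embeddings ℚ ℂ y
  rw [← norm_prod, ← h, ← hm]
  simpa [Int.norm_eq_abs] using (by exact_mod_cast Int.one_le_abs hm0 : (1 : ℝ) ≤ |(m : ℝ)|)

/-- A Liouville inequality for the distance of `α ζ ^ n` to the integers. -/
theorem exists_pow_le_mul_abs_sub {α ζ : ℝ} (hα : IsAlgebraic ℚ α) (hζ : IsAlgebraic ℚ ζ)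
    (hζ1 : 1 < ζ) {H : ℕ} (hH : height ζ ≤ H) :
    ∃ D : ℕ, D ≤ degree α * degree ζ ∧ ∃ C : ℝ, 0 < C ∧ ∀ (n : ℕ) (N : ℤ), α * ζ ^ n ≠ N →
      |α * ζ ^ n - N| ≤ 1 → ζ ^ n ≤ C * ((2 * H : ℝ) ^ D) ^ n * |α * ζ ^ n - N| := by
  classical
  obtain ⟨K, hKfin, hKdeg, hαK, hζK⟩ : ∃ K : IntermediateField ℚ ℝ, FiniteDimensional ℚ K ∧
      Module.finrank ℚ K ≤ degree α * degree ζ ∧ α ∈ K ∧ ζ ∈ K := by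
    have := IntermediateField.adjoin.finiteDimensional hα.isIntegral
    have := IntermediateField.adjoin.finiteDimensional hζ.isIntegral
    refine ⟨IntermediateField.adjoin ℚ {α} ⊔ IntermediateField.adjoin ℚ {ζ},
      IntermediateField.finiteDimensional_sup _ _, IntermediateField.finrank_sup_le _ _, ?_, ?_⟩
    · exact le_sup_left (a := IntermediateField.adjoin ℚ {α})
        (IntermediateField.mem_adjoin_simple_self ℚ α)
    · exact le_sup_right (b := IntermediateField.adjoin ℚ {ζ})
        (IntermediateField.mem_adjoin_simple_self ℚ ζ)
  have : NumberField K := {}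
  refine ⟨Module.finrank ℚ K, hKdeg, ?_⟩
  obtain ⟨x, rfl⟩ : ∃ x : K, (x : ℝ) = α := ⟨⟨α, hαK⟩, rfl⟩
  obtain ⟨z, rfl⟩ : ∃ z : K, (z : ℝ) = ζ := ⟨⟨ζ, hζK⟩, rfl⟩
  set P := intMinpoly (z : ℝ) with hP
  have hP0 : P ≠ 0 := intMinpoly_ne_zero _
  have hPz : aeval z P = 0 := by
    have := aeval_intMinpoly hζ
    rw [← hP] at this
    have h2 : algebraMap K ℝ (aeval z P) = 0 := by
      rw [← aeval_algebraMap_apply]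
      exact this
    exact (map_eq_zero _).mp h2
  set a := P.leadingCoeff with ha
  have ha0 : a ≠ 0 := leadingCoeff_ne_zero.mpr hP0
  have haz : IsIntegral ℤ (a • z) := isIntegral_leadingCoeff_smul P z hPz
  obtain ⟨b, hb0, hbx⟩ :=
    ((IsFractionRing.isAlgebraic_iff ℤ ℚ K).mpr (Algebra.IsAlgebraic.isAlgebraic x)).exists_integral_multiple
  have hσz (σ : K →ₐ[ℚ] ℂ) : |(a : ℝ)| * ‖σ z‖ ≤ 2 * H := by
    refine norm_leadingCoeff_mul_root_le hP0 hH ?_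
    have : aeval ((σ.restrictScalars ℤ) z) P = 0 := by
      rw [aeval_algHom_apply, hPz, map_zero]
    exact this
  let σ₀ : K →ₐ[ℚ] ℂ := (Algebra.algHom ℚ ℝ ℂ).comp K.val
  have hσ₀ (y : K) : ‖σ₀ y‖ = |(y : ℝ)| := by
    change ‖((y : ℝ) : ℂ)‖ = _
    simp
  have hz0 : |(a : ℝ)| * (z : ℝ) ≤ 2 * H := by
    have := hσz σ₀
    rwa [hσ₀, abs_of_pos (by linarith : (0 : ℝ) < z)] at this
  -- The summand `|x| + 1` accounts for `N`, since `|N| ≤ (|x| + 1) zⁿ` once `|x zⁿ - N| ≤ 1`.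
  let c : (K →ₐ[ℚ] ℂ) → ℝ := fun σ => |(b : ℝ)| * (‖σ x‖ + |(x : ℝ)| + 1)
  have hb1 : 0 < |(b : ℝ)| := by simpa using hb0
  have ha1 : 0 < |(a : ℝ)| := by simpa using ha0
  have hc (σ) : 0 < c σ := by positivity
  refine ⟨|(b : ℝ)| * ∏ σ ∈ Finset.univ.erase σ₀, c σ,
    mul_pos hb1 (Finset.prod_pos fun σ _ => hc σ), fun n N hne hle => ?_⟩
  set ε := |(x : ℝ) * (z : ℝ) ^ n - N| with hε
  let y : K := (b • x) * (a • z) ^ n - ((b * a ^ n * N : ℤ) : K)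
  have hyint : IsIntegral ℤ y :=
    (hbx.mul (haz.pow n)).sub (isIntegral_algebraMap (R := ℤ) (A := K) (x := b * a ^ n * N))
  have hy : y = ((b * a ^ n : ℤ) : K) * (x * z ^ n - (N : K)) := by
    simp only [y, zsmul_eq_mul, mul_pow]
    push_cast
    ring
  have hσy (σ : K →ₐ[ℚ] ℂ) :
      ‖σ y‖ = |(b : ℝ)| * |(a : ℝ)| ^ n * ‖σ x * σ z ^ n - (N : ℂ)‖ := by
    rw [hy]
    simp [norm_pow]
  have hσ₀y : ‖σ₀ y‖ = |(b : ℝ)| * |(a : ℝ)| ^ n * ε := by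
    rw [hσ₀, hy, hε]
    simp [abs_mul, abs_pow]
  have hy0 : y ≠ 0 := by
    intro h
    have := hσ₀y
    rw [h, map_zero, norm_zero] at this
    have hε0 : 0 < ε := abs_pos.mpr (sub_ne_zero.mpr hne)
    have : 0 < |(b : ℝ)| * |(a : ℝ)| ^ n * ε := by positivity
    linarith
  have hzn : 1 ≤ (z : ℝ) ^ n := one_le_pow₀ hζ1.le
  have hN : |(N : ℝ)| ≤ (|(x : ℝ)| + 1) * (z : ℝ) ^ n := by
    have h1 : |(N : ℝ)| ≤ |(x : ℝ) * (z : ℝ) ^ n| + ε := by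
      have := abs_sub_abs_le_abs_sub (N : ℝ) ((x : ℝ) * (z : ℝ) ^ n)
      rw [abs_sub_comm] at this
      linarith
    rw [abs_mul, abs_of_pos (by linarith : 0 < (z : ℝ) ^ n)] at h1
    linarith
  have hbound (σ : K →ₐ[ℚ] ℂ) : ‖σ y‖ ≤ c σ * (2 * H : ℝ) ^ n := by
    have h1 : (|(a : ℝ)| * ‖σ z‖) ^ n ≤ (2 * H : ℝ) ^ n :=
      pow_le_pow_left₀ (by positivity) (hσz σ) n
    have h2 : (|(a : ℝ)| * (z : ℝ)) ^ n ≤ (2 * H : ℝ) ^ n :=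
      pow_le_pow_left₀ (by positivity) hz0 n
    rw [mul_pow] at h1 h2
    have h3 : ‖σ x * σ z ^ n - (N : ℂ)‖ ≤ ‖σ x‖ * ‖σ z‖ ^ n + (|(x : ℝ)| + 1) * (z : ℝ) ^ n := by
      refine (norm_sub_le _ _).trans ?_
      rw [norm_mul, norm_pow]
      simpa using hN
    rw [hσy]
    calc |(b : ℝ)| * |(a : ℝ)| ^ n * ‖σ x * σ z ^ n - (N : ℂ)‖
        ≤ |(b : ℝ)| * |(a : ℝ)| ^ n *
          (‖σ x‖ * ‖σ z‖ ^ n + (|(x : ℝ)| + 1) * (z : ℝ) ^ n) := by gcongr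
      _ = |(b : ℝ)| * (‖σ x‖ * (|(a : ℝ)| ^ n * ‖σ z‖ ^ n) +
          (|(x : ℝ)| + 1) * (|(a : ℝ)| ^ n * (z : ℝ) ^ n)) := by ring
      _ ≤ |(b : ℝ)| * (‖σ x‖ * (2 * H : ℝ) ^ n + (|(x : ℝ)| + 1) * (2 * H : ℝ) ^ n) := by gcongr
      _ = c σ * (2 * H : ℝ) ^ n := by ring
  have hprod := one_le_norm_prod_embeddings hyint hy0
  -- The embedding `σ₀` is kept apart: only its factor retains `ε`; the others get the crude bound.
  rw [← Finset.mul_prod_erase _ _ (Finset.mem_univ σ₀), hσ₀y] at hprod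
  have hrest : ∏ σ ∈ Finset.univ.erase σ₀, ‖σ y‖ ≤
      (∏ σ ∈ Finset.univ.erase σ₀, c σ) * ((2 * H : ℝ) ^ n) ^ (Module.finrank ℚ K - 1) := by
    refine (Finset.prod_le_prod (fun _ _ => norm_nonneg _) fun σ _ => hbound σ).trans_eq ?_
    rw [Finset.prod_mul_distrib, Finset.prod_const, Finset.card_erase_of_mem (Finset.mem_univ _),
      Finset.card_univ, AlgHom.card]
  have hc0 : 0 < ∏ σ ∈ Finset.univ.erase σ₀, c σ := Finset.prod_pos fun σ _ => hc σ
  have hDpos : 0 < Module.finrank ℚ K := Module.finrank_pos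
  calc (z : ℝ) ^ n = (z : ℝ) ^ n * 1 := (mul_one _).symm
    _ ≤ (z : ℝ) ^ n * (|(b : ℝ)| * |(a : ℝ)| ^ n * ε * ∏ σ ∈ Finset.univ.erase σ₀, ‖σ y‖) := by
      gcongr
    _ ≤ (z : ℝ) ^ n * (|(b : ℝ)| * |(a : ℝ)| ^ n * ε *
        ((∏ σ ∈ Finset.univ.erase σ₀, c σ) * ((2 * H : ℝ) ^ n) ^ (Module.finrank ℚ K - 1))) := by
      gcongr
    -- The extra `zⁿ` is absorbed by the `|a|ⁿ` from `σ₀`; this is the source of the `-1` in the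
    -- final bound.
    _ = (|(a : ℝ)| * (z : ℝ)) ^ n * (|(b : ℝ)| * ε * ((∏ σ ∈ Finset.univ.erase σ₀, c σ) *
        ((2 * H : ℝ) ^ n) ^ (Module.finrank ℚ K - 1))) := by rw [mul_pow]; ring
    _ ≤ (2 * H : ℝ) ^ n * (|(b : ℝ)| * ε * ((∏ σ ∈ Finset.univ.erase σ₀, c σ) *
        ((2 * H : ℝ) ^ n) ^ (Module.finrank ℚ K - 1))) := by gcongr
    _ = |(b : ℝ)| * (∏ σ ∈ Finset.univ.erase σ₀, c σ) *
        ((2 * H : ℝ) ^ n) ^ (Module.finrank ℚ K - 1 + 1) * ε := by ring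
    _ = _ := by rw [Nat.sub_add_cancel hDpos, ← pow_mul, ← pow_mul, mul_comm n]

/-! ### From the inequality to the limsup -/

theorem distInt_eq_zero_iff {x : ℝ} : distInt x = 0 ↔ ∃ m : ℤ, x = m := by
  rw [distInt, abs_eq_zero, sub_eq_zero]
  refine ⟨fun h => ⟨_, h⟩, ?_⟩
  rintro ⟨m, rfl⟩
  simp

-- Logarithms bound `σₙ` by `(log C + n (log Q - log ζ)) / (log |α| + n log ζ)` for large `n`; the
-- constants vanish in the limit. The hypothesis `hne` excludes the value `⊤`.
open Filter Topology in
theorem sigmaSup_le_of_pow_le {α ζ C Q : ℝ} (hα : α ≠ 0) (hζ : 1 < ζ) (hC : 0 < C) (hQ : 0 < Q)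
    (hle : ∀ (n : ℕ) (N : ℤ), α * ζ ^ n ≠ N → |α * ζ ^ n - N| ≤ 1 →
      ζ ^ n ≤ C * Q ^ n * |α * ζ ^ n - N|)
    (hne : ∀ᶠ n : ℕ in atTop, distInt (α * ζ ^ n) ≠ 0) :
    sigmaSup α ζ ≤ ((Real.log Q / Real.log ζ - 1 : ℝ) : EReal) := by
  have hu : 0 < Real.log ζ := Real.log_pos hζ
  let f : ℕ → ℝ := fun n =>
    (Real.log C + n * (Real.log Q - Real.log ζ)) / (Real.log |α| + n * Real.log ζ)
  have hf : Tendsto f atTop (𝓝 (Real.log Q / Real.log ζ - 1)) := by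
    have h1 : Tendsto (fun n : ℕ => (Real.log C / n + (Real.log Q - Real.log ζ)) /
        (Real.log |α| / n + Real.log ζ)) atTop
        (𝓝 ((0 + (Real.log Q - Real.log ζ)) / (0 + Real.log ζ))) :=
      ((tendsto_const_div_atTop_nhds_zero_nat _).add_const _).div
        ((tendsto_const_div_atTop_nhds_zero_nat _).add_const _) (by simpa using hu.ne')
    have h2 : (0 + (Real.log Q - Real.log ζ)) / (0 + Real.log ζ) =
        Real.log Q / Real.log ζ - 1 := by field_simp; ring
    rw [h2] at h1
    refine h1.congr' ?_
    filter_upwards [eventually_gt_atTop 0] with n hn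
    have hn' : (n : ℝ) ≠ 0 := by positivity
    rw [← mul_div_mul_left _ _ hn', mul_add, mul_add, mul_div_cancel₀ _ hn', mul_div_cancel₀ _ hn']
  have hden : ∀ᶠ n : ℕ in atTop, 0 < Real.log |α| + n * Real.log ζ :=
    (tendsto_atTop_add_const_left _ _
      (tendsto_natCast_atTop_atTop.atTop_mul_const hu)).eventually_gt_atTop 0
  have hfE : Tendsto (fun n => (f n : EReal)) atTop
      (𝓝 ((Real.log Q / Real.log ζ - 1 : ℝ) : EReal)) :=
    (continuous_coe_real_ereal.tendsto _).comp hf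
  rw [← hfE.limsup_eq]
  refine limsup_le_limsup ?_
  filter_upwards [hne, hden] with n hn hd
  rw [sigma, if_neg hn, EReal.coe_le_coe_iff]
  have hζn : 0 < ζ ^ n := by positivity
  have hlog : Real.log |α * ζ ^ n| = Real.log |α| + n * Real.log ζ := by
    rw [abs_mul, abs_of_pos hζn, Real.log_mul (abs_ne_zero.mpr hα) hζn.ne', Real.log_pow]
  have hε : 0 < distInt (α * ζ ^ n) := lt_of_le_of_ne (abs_nonneg _) hn.symm
  have h1 : ζ ^ n ≤ C * Q ^ n * distInt (α * ζ ^ n) := by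
    refine hle n (round (α * ζ ^ n)) (fun h => hn (distInt_eq_zero_iff.mpr ⟨_, h⟩)) ?_
    exact (abs_sub_round _).trans (by norm_num)
  have h2 := Real.log_le_log hζn h1
  rw [Real.log_mul (by positivity) hε.ne', Real.log_mul hC.ne' (by positivity), Real.log_pow,
    Real.log_pow] at h2
  rw [hlog, ← neg_div]
  refine (div_le_div_iff_of_pos_right hd).mpr ?_
  linarith

/-! ### Sequences with infinitely many integer terms -/

theorem eq_rpow_div_of_pow_eq {ζ : ℝ} (hζ : 0 < ζ) {L : ℕ} (hL : 0 < L) (x : ℝ)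
    {M : ℝ} (h : ζ ^ L = M) : M ^ (x / L) = ζ ^ x := by
  rw [← h, ← Real.rpow_natCast, ← Real.rpow_mul hζ.le]
  congr 1
  field_simp

/-- If two distinct elements of the sequence `α ζ ^ n` are integers, a power of `ζ` is rational. -/
theorem exists_pow_mul_eq_of_mul_pow_eq_intCast {α ζ : ℝ} (hα : α ≠ 0) (hζ : 0 < ζ) {m n : ℕ}
    (hmn : m < n) {A B : ℤ} (hA : α * ζ ^ m = A) (hB : α * ζ ^ n = B) :
    ∃ r : ℚ, 0 < r ∧ ζ ^ (n - m) = r := by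
  have hA0 : (A : ℝ) ≠ 0 := by rw [← hA]; positivity
  have h : ζ ^ (n - m) = ((B / A : ℚ) : ℝ) := by
    push_cast
    rw [eq_div_iff hA0, ← hA, ← hB, mul_left_comm, ← pow_add, Nat.sub_add_cancel hmn.le]
  refine ⟨B / A, ?_, h⟩
  have : 0 < ζ ^ (n - m) := by positivity
  rw [h] at this
  exact_mod_cast this

theorem isRootOfIntDiv_of_pow_eq_ratCast {ζ : ℝ} (hζ : 0 < ζ) {L : ℕ} (hL : 0 < L) {r : ℚ}
    (hr : 0 < r) (h : ζ ^ L = r) : IsRootOfIntDiv ζ := by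
  have hnum : 0 < r.num := Rat.num_pos.mpr hr
  have hden : (0 : ℤ) < r.den := by exact_mod_cast r.den_pos
  have hden' : (0 : ℝ) < r.den := by exact_mod_cast r.den_pos
  -- From `ζ ^ L = num / den` comes `(ζ den) ^ L = num · den ^ (L - 1)`.
  refine ⟨L, r.num * r.den ^ (L - 1), r.den, by exact_mod_cast hL, by positivity, hden, ?_⟩
  have h1 : (ζ * r.den) ^ L = ((r.num * r.den ^ (L - 1) : ℤ) : ℝ) := by
    obtain ⟨l, rfl⟩ : ∃ l, L = l + 1 := ⟨L - 1, by omega⟩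
    rw [mul_pow, h]
    nth_rewrite 1 [← Rat.num_div_den r]
    push_cast
    rw [pow_succ (r.den : ℝ)]
    field_simp
  have h2 := eq_rpow_div_of_pow_eq (by positivity) hL 1 h1
  rw [Int.cast_natCast, h2, Real.rpow_one, Int.cast_natCast]
  field_simp

open Filter in
theorem isRootOfIntDiv_of_frequently {α ζ : ℝ} (hα : α ≠ 0) (hζ : 1 < ζ)
    (h : ∃ᶠ n : ℕ in atTop, distInt (α * ζ ^ n) = 0) : IsRootOfIntDiv ζ := by
  obtain ⟨m, -, hm⟩ := frequently_atTop.mp h 0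
  obtain ⟨n, hn, hn'⟩ := frequently_atTop.mp h (m + 1)
  obtain ⟨A, hA⟩ := distInt_eq_zero_iff.mp hm
  obtain ⟨B, hB⟩ := distInt_eq_zero_iff.mp hn'
  obtain ⟨r, hr, hrζ⟩ :=
    exists_pow_mul_eq_of_mul_pow_eq_intCast hα (by linarith) (by omega) hA hB
  exact isRootOfIntDiv_of_pow_eq_ratCast (by linarith) (by omega) hr hrζ

-- With `ζ ^ L = r` rational, integrality of arbitrarily late terms makes arbitrarily high powers of
-- the denominator of `r` divide one fixed nonzero integer, so `r` is an integer.
open Filter in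
theorem isExceptionalPair_of_frequently {α ζ : ℝ} (hα : α ≠ 0) (hζ : 1 < ζ)
    (h : ∃ᶠ n : ℕ in atTop, distInt (α * ζ ^ n) = 0) : IsExceptionalPair α ζ := by
  -- Starting from `1` makes `m` positive, as it will serve as `g`.
  obtain ⟨m, hm0, hm⟩ := frequently_atTop.mp h 1
  obtain ⟨n, hn, hn'⟩ := frequently_atTop.mp h (m + 1)
  obtain ⟨A, hA⟩ := distInt_eq_zero_iff.mp hm
  obtain ⟨B, hB⟩ := distInt_eq_zero_iff.mp hn'
  have hζ0 : 0 < ζ := by linarith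
  obtain ⟨r, hr, hrζ⟩ :=
    exists_pow_mul_eq_of_mul_pow_eq_intCast hα hζ0 (by omega : m < n) hA hB
  obtain ⟨L, hL⟩ : ∃ L, L = n - m := ⟨_, rfl⟩
  rw [← hL] at hrζ
  have hL0 : 0 < L := by omega
  have hA0 : A ≠ 0 := by
    rintro rfl
    have : α * ζ ^ m ≠ 0 := by positivity
    exact this (by simpa using hA)
  have hdvd : ∀ N : ℕ, ∃ j, N ≤ j ∧ (r.den : ℤ) ^ j ∣ A ^ L := by
    intro N
    obtain ⟨p, hp, hp'⟩ := frequently_atTop.mp h (m + N)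
    obtain ⟨E, hE⟩ := distInt_eq_zero_iff.mp hp'
    refine ⟨p - m, by omega, ?_⟩
    -- Raising `E = A ζ ^ (p - m)` to the `L`-th power leaves only rational quantities, even when
    -- `L` does not divide `p - m`.
    have h1 : (E : ℝ) ^ L = (A : ℝ) ^ L * (r : ℝ) ^ (p - m) := by
      rw [← hE, ← hA, ← hrζ]
      obtain ⟨q, rfl⟩ : ∃ q, p = m + q := ⟨p - m, by omega⟩
      rw [Nat.add_sub_cancel_left]
      ring
    have h2 : (E : ℚ) ^ L = (A : ℚ) ^ L * r ^ (p - m) := by exact_mod_cast h1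
    have h3 : E ^ L * (r.den : ℤ) ^ (p - m) = A ^ L * r.num ^ (p - m) := by
      have hd : (r.den : ℚ) ≠ 0 := by exact_mod_cast r.den_ne_zero
      have : (E : ℚ) ^ L * (r.den : ℚ) ^ (p - m) = (A : ℚ) ^ L * (r.num : ℚ) ^ (p - m) := by
        rw [h2, mul_assoc, ← mul_pow, Rat.mul_den_eq_num]
      exact_mod_cast this
    have hcop : IsCoprime ((r.den : ℤ) ^ (p - m)) (r.num ^ (p - m)) :=
      r.isCoprime_num_den.symm.pow
    exact hcop.dvd_of_dvd_mul_right ⟨E ^ L, by rw [← h3, mul_comm]⟩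
  have hden : r.den = 1 := by
    by_contra hne
    have h2 : 2 ≤ r.den := by have := r.den_pos; omega
    obtain ⟨j, hj, hj'⟩ := hdvd (A ^ L).natAbs
    have h3 : r.den ^ j ∣ (A ^ L).natAbs := by
      rw [← Int.natCast_dvd]
      exact_mod_cast hj'
    have h4 := Nat.le_of_dvd (Int.natAbs_pos.mpr (pow_ne_zero _ hA0)) h3
    have h5 : j < 2 ^ j := Nat.lt_two_pow_self
    have h6 := Nat.pow_le_pow_left h2 j
    omega
  have hM : ζ ^ L = (r.num : ℝ) := by
    rw [hrζ]
    exact_mod_cast (Rat.den_eq_one_iff r).mp hden |>.symm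
  have key (x : ℝ) := eq_rpow_div_of_pow_eq hζ0 hL0 x hM
  -- Here `α = A ζ ^ (-m)` with `ζ = M ^ (1 / L)`, so `B = 1` and `g = m`.
  refine ⟨L, r.num, A, 1, m, by exact_mod_cast hL0, Rat.num_pos.mpr hr, hA0, one_pos,
    by exact_mod_cast hm0, ?_, ?_⟩
  · rw [Int.cast_natCast, Int.cast_natCast, key, Real.rpow_neg hζ0.le, Real.rpow_natCast, ← hA]
    field_simp
    simp
  · rw [Int.cast_natCast, key, Real.rpow_one]

/-! ### Assembling the bounds -/

theorem IsExceptionalPair.isRootOfInt {α ζ : ℝ} (h : IsExceptionalPair α ζ) : IsRootOfInt ζ := by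
  obtain ⟨L, M, -, -, -, hL, hM, -, -, -, -, hζ⟩ := h
  exact ⟨L, M, hL, hM, hζ⟩

open Filter in
theorem exists_sigmaSup_le {α ζ : ℝ} (hα : IsAlgebraic ℚ α) (hα0 : α ≠ 0) (hζ : IsAlgebraic ℚ ζ)
    (hζ1 : 1 < ζ) {H : ℕ} (hH0 : 0 < H) (hH : height ζ ≤ H)
    (hint : ¬ ∃ᶠ n : ℕ in atTop, distInt (α * ζ ^ n) = 0) :
    ∃ D : ℕ, D ≤ degree α * degree ζ ∧
      sigmaSup α ζ ≤ ((D * Real.log (2 * H) / Real.log ζ - 1 : ℝ) : EReal) := by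
  obtain ⟨D, hD, C, hC, hle⟩ := exists_pow_le_mul_abs_sub hα hζ hζ1 hH
  refine ⟨D, hD, ?_⟩
  rw [← Real.log_pow]
  exact sigmaSup_le_of_pow_le hα0 hζ1 hC (by positivity) hle (not_frequently.mp hint)

end PowModOne

theorem mainTheorem7 :
    -- finiteness outside the exceptional pairs
    (∀ α ζ : ℝ, IsAlgebraic ℚ α → α ≠ 0 → IsAlgebraic ℚ ζ → 1 < ζ →
      ¬ PowModOne.IsExceptionalPair α ζ → PowModOne.sigmaSup α ζ < ⊤) ∧
    -- in particular, finiteness for every `α` if `ζ` is not a root of an integer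
    (∀ ζ : ℝ, IsAlgebraic ℚ ζ → 1 < ζ → ¬ PowModOne.IsRootOfInt ζ →
      ∀ α : ℝ, IsAlgebraic ℚ α → α ≠ 0 → PowModOne.sigmaSup α ζ < ⊤) ∧
    -- the explicit bound
    (∀ k t H : ℕ, 0 < k → 0 < t → 2 ≤ H →
      ∀ ζ : ℝ, IsAlgebraic ℚ ζ → 1 < ζ → ¬ PowModOne.IsRootOfIntDiv ζ →
        PowModOne.degree ζ ≤ k → PowModOne.height ζ ≤ H →
      ∀ α : ℝ, IsAlgebraic ℚ α → α ≠ 0 → PowModOne.degree α ≤ t →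
        PowModOne.sigmaSup α ζ ≤ (PowModOne.explicitBound k t H : EReal) ∧
        PowModOne.sigmaSup α ζ < ⊤) := by
  have hfin : ∀ α ζ : ℝ, IsAlgebraic ℚ α → α ≠ 0 → IsAlgebraic ℚ ζ → 1 < ζ →
      ¬ PowModOne.IsExceptionalPair α ζ → PowModOne.sigmaSup α ζ < ⊤ := by
    intro α ζ hα hα0 hζ hζ1 hex
    obtain ⟨D, -, hD⟩ := PowModOne.exists_sigmaSup_le hα hα0 hζ hζ1
      (Nat.succ_pos (PowModOne.height ζ)) (Nat.le_succ _)
      fun h => hex (PowModOne.isExceptionalPair_of_frequently hα0 hζ1 h)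
    exact hD.trans_lt (EReal.coe_lt_top _)
  refine ⟨hfin, fun ζ hζ hζ1 hroot α hα hα0 =>
    hfin α ζ hα hα0 hζ hζ1 fun h => hroot h.isRootOfInt, ?_⟩
  intro k t H hk _ hH2 ζ hζ hζ1 hroot hdeg hheight α hα hα0 hdegα
  obtain ⟨D, hD, hle⟩ := PowModOne.exists_sigmaSup_le hα hα0 hζ hζ1 (by omega) hheight
    fun h => hroot (PowModOne.isRootOfIntDiv_of_frequently hα0 hζ1 h)
  have hgap := PowModOne.one_le_mul_log_of_root hk hH2
    ((PowModOne.natDegree_intMinpoly_le hζ).trans hdeg)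
    (PowModOne.abs_coeff_le_of_polyHeight_le hheight) hζ1 (PowModOne.aeval_intMinpoly hζ)
    (PowModOne.intMinpoly_eval_one_ne_zero hζ hζ1.ne')
  have hbound : PowModOne.sigmaSup α ζ ≤ (PowModOne.explicitBound k t H : EReal) :=
    hle.trans <| EReal.coe_le_coe_iff.mpr <|
      PowModOne.mul_log_two_mul_div_log_le_explicitBound hk hH2
        (hD.trans (Nat.mul_le_mul hdegα hdeg)) (Real.log_pos hζ1) hgap
  exact ⟨hbound, hbound.trans_lt (EReal.coe_lt_top _)⟩
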